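/- Let $\mathbb T^1=\mathbb R/\mathbb Z$ and $\mathbb T^2=\mathbb T^1\times\mathbb T^1$. For a homeomorphism $f$ of a compact metric space $(X,d)$, a point $x$ is called distal if $\inf_{n\in\mathbb Z}d(f^n(x),f^n(y))>0$ for all $y\ne x$; $f$ is point-distal if it has a distal point, and distal if all points are distal. $f$ is almost automorphic if there is a point $x$ such that, for every integer sequence $(n_k)$, $f^{n_k}(x)\to\tilde x$ implies $f^{-n_k}(\tilde x)\to x$. **Proposition (Rees).** There exists a minimal homeomorphism $f$ of $\mathbb T^2$ that is almost automorphic and point-distal, but not distal. Moreover, $f$ can be obtained by blowing up one orbit of an irrational rotation to vertical segments, by means of quantile functions, in the following sense. There exist * $\omega,\rho\in\mathbb T^1$ such that $1,\omega,\rho$ are rationally independent; let $R(\theta,x)=(\theta+\omega,x+\rho)$; * weights $a_n>0$ $(n\in\mathbb Z)$ with $\sum_n a_n<1$; let $b=1-\sum_n a_n$; * a point $\theta^*\in\mathbb T^1$ and continuous functions $\gamma:\mathbb T^1\to(0,1)$ and $\psi,\varphi:\mathbb T^1\to[0,1]$ with $\psi\le\gamma\le\varphi$, with $\varphi=\gamma$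 on a left neighbourhood and $\psi=\gamma$ on a right neighbourhood of $\theta^*$, and with $\psi<\varphi$ on $\mathbb T^1\setminus\{\theta^*\}$, such that the $R$-orbit $O$ of $z^*=(\theta^*,\gamma(\theta^*))$ does not meet $\mathbb T^1\times\{0\}$; such that the following holds. Let $\mu^0_{\theta^*}=\delta_{\gamma(\theta^*)}$, let $\mu^0_\theta$ be the uniform probability measure on $[\psi(\theta),\varphi(\theta)]$ for $\theta\neq\theta^*$, let $\mu^n_\theta$ be the image of $\mu^0_{\theta-n\omega}$ under $x\mapsto x+n\rho$, and let $$\mu_\theta=\sum_{n\in\mathbb Z}a_n\mu^n_\theta+b\,\mathrm{Leb}_{\mathbb T^1}.$$ Define $h(\theta,x)=(\theta,h_\theta(x))$ with $h_\theta(x)=\min\{y\in[0,1)\mid\mu_\theta[0,y]\ge x\}$ for $x\in[0,1)$, where $\mathbb T^1$ is identified with $[0,1)$ (the minimum exists). Then: 1. $f$ has the form $f(\theta,x)=(\theta+\omega,f_\theta(x))$, and $h$ is a continuous surjection with $h\circ f=R\circ h$; 2. $h^{-1}\{z\}$ is a nondegenerate vertical segment for every $z\in O$, and it is a single point for every $z\notin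 O$; 3. the set of non-distal points of $f$ is exactly $h^{-1}(O)$. -/

import Mathlib

open Set Filter Topology MeasureTheory

namespace ReesTorus

/-! ### Topological dynamics of a homeomorphism -/

section Dynamics

/-- The two-sided orbit of `x` under `f`. -/
def orbit {X : Type*} [TopologicalSpace X] (f : X ≃ₜ X) (x : X) : Set X :=
  Set.range fun n : ℤ => (f ^ n) x

/-- `f` is minimal: every orbit is dense. -/
def IsMinimal {X : Type*} [TopologicalSpace X] (f : X ≃ₜ X) : Prop :=
  ∀ x : X, Dense (orbit f x)

/-- `x` is a distal point of `f`: its orbit stays a positive distance away from the simultaneous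
orbit of every other point. -/
def IsDistalPoint {X : Type*} [MetricSpace X] (f : X ≃ₜ X) (x : X) : Prop :=
  ∀ y : X, y ≠ x → 0 < ⨅ n : ℤ, dist ((f ^ n) x) ((f ^ n) y)

/-- `f` is point-distal: it has a distal point. -/
def IsPointDistal {X : Type*} [MetricSpace X] (f : X ≃ₜ X) : Prop :=
  ∃ x : X, IsDistalPoint f x

/-- `f` is distal: all points are distal. -/
def IsDistal {X : Type*} [MetricSpace X] (f : X ≃ₜ X) : Prop :=
  ∀ x : X, IsDistalPoint f x

/-- `f` is almost automorphic. -/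
def IsAlmostAutomorphic {X : Type*} [TopologicalSpace X] (f : X ≃ₜ X) : Prop :=
  ∃ x : X, ∀ (n : ℕ → ℤ) (y : X),
    Tendsto (fun k => (f ^ (n k)) x) atTop (𝓝 y) →
      Tendsto (fun k => (f ^ (-(n k))) y) atTop (𝓝 x)

/-- `h` is a factor map (semiconjugacy) from `(X, f)` onto `(Y, g)`. -/
def IsFactorMap {X Y : Type*} [TopologicalSpace X] [TopologicalSpace Y]
    (f : X ≃ₜ X) (g : Y ≃ₜ Y) (h : X → Y) : Prop :=
  Continuous h ∧ Function.Surjective h ∧ ∀ p : X, h (f p) = g (h p)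

end Dynamics

/-! ### The two-torus -/

/-- The two-torus `𝕋¹ × 𝕋¹`, with `𝕋¹ = ℝ / ℤ`. -/
abbrev Torus : Type := UnitAddCircle × UnitAddCircle

/-- The rotation `(θ, x) ↦ (θ + ω, x + ρ)` of the two-torus. -/
noncomputable def rotation (ω ρ : UnitAddCircle) : Torus ≃ₜ Torus :=
  Homeomorph.addRight ((ω, ρ) : Torus)

/-- The rotation by `(ω, ρ)` is irrational: `1, ω, ρ` are rationally independent. -/
def IsIrrationalRotation (ω ρ : UnitAddCircle) : Prop :=
  ∀ k l : ℤ, k • ω + l • ρ = 0 → k = 0 ∧ l = 0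

/-- A nondegenerate vertical segment `{θ} × [c, d]` in the torus (a proper closed arc of the
vertical circle over `θ`, with more than one point). -/
def IsVerticalSegment (S : Set Torus) : Prop :=
  ∃ (θ : UnitAddCircle) (c d : ℝ), c < d ∧ d < c + 1 ∧
    S = ({θ} : Set UnitAddCircle) ×ˢ ((fun t : ℝ => (t : UnitAddCircle)) '' Icc c d)

/-! ### The measures and their quantile functions -/

/-- `q : 𝕋¹ → 𝕋¹` is the quantile function `x ↦ min {y | ν [0, y] ≥ x}` of the measure `ν`,
where `𝕋¹` is identified with `[0, 1)`. -/
def IsQuantile (ν : Measure UnitAddCircle) (q : UnitAddCircle → UnitAddCircle) : Prop :=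
  ∀ x ∈ Ico (0 : ℝ) 1, ∃ y : ℝ,
    IsLeast {y : ℝ | y ∈ Ico (0 : ℝ) 1 ∧
      ENNReal.ofReal x ≤ ν ((fun t : ℝ => (t : UnitAddCircle)) '' Icc 0 y)} y ∧
    q (x : UnitAddCircle) = (y : UnitAddCircle)

/-- The choices made when the orbit of the point `(θs, γ θs)` under an irrational rotation is
blown up: the weights `a n` and the curves `ψ ≤ γ ≤ φ`. -/
structure BlowUpData where
  ω : UnitAddCircle
  ρ : UnitAddCircle
  irrational : IsIrrationalRotation ω ρ
  /-- the weights -/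
  a : ℤ → ℝ
  a_pos : ∀ n, 0 < a n
  a_summable : Summable a
  a_sum_lt_one : ∑' n, a n < 1
  /-- the first coordinate of the point whose orbit is blown up -/
  θs : UnitAddCircle
  γ : UnitAddCircle → ℝ
  ψ : UnitAddCircle → ℝ
  φ : UnitAddCircle → ℝ
  γ_cont : Continuous γ
  ψ_cont : Continuous ψ
  φ_cont : Continuous φ
  γ_mem : ∀ θ, γ θ ∈ Ioo (0 : ℝ) 1
  ψ_mem : ∀ θ, ψ θ ∈ Icc (0 : ℝ) 1
  φ_mem : ∀ θ, φ θ ∈ Icc (0 : ℝ) 1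
  ψ_le : ∀ θ, ψ θ ≤ γ θ
  le_φ : ∀ θ, γ θ ≤ φ θ
  /-- `φ = γ` on a left neighbourhood of `θs` -/
  φ_left : ∀ᶠ t : ℝ in 𝓝[≤] 0, φ (θs + (t : UnitAddCircle)) = γ (θs + (t : UnitAddCircle))
  /-- `ψ = γ` on a right neighbourhood of `θs` -/
  ψ_right : ∀ᶠ t : ℝ in 𝓝[≥] 0, ψ (θs + (t : UnitAddCircle)) = γ (θs + (t : UnitAddCircle))
  ψ_lt_φ : ∀ θ, θ ≠ θs → ψ θ < φ θ
  /-- the orbit of `(θs, γ θs)` does not meet the circle `𝕋¹ × {0}` -/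
  orbit_avoids : ∀ n : ℤ, (γ θs : UnitAddCircle) + n • ρ ≠ 0

namespace BlowUpData

/-- The irrational rotation. -/
noncomputable def rot (D : BlowUpData) : Torus ≃ₜ Torus := rotation D.ω D.ρ

/-- The point whose orbit is blown up. -/
noncomputable def point (D : BlowUpData) : Torus := (D.θs, (D.γ D.θs : UnitAddCircle))

open Classical in
/-- The fibre measure `μ⁰_θ`: the point mass at `γ θs` if `θ = θs`, and otherwise the uniform
probability measure on `[ψ θ, φ θ]`. -/
noncomputable def fibre₀ (D : BlowUpData) (θ : UnitAddCircle) : Measure UnitAddCircle :=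
  if θ = D.θs then Measure.dirac (D.γ D.θs : UnitAddCircle)
  else Measure.map (fun t : ℝ => (t : UnitAddCircle))
    ((ENNReal.ofReal (D.φ θ - D.ψ θ))⁻¹ • (volume : Measure ℝ).restrict (Icc (D.ψ θ) (D.φ θ)))

/-- The fibre measure `μⁿ_θ` of the image of `μ⁰` under the `n`-th iterate of the rotation. -/
noncomputable def fibreIter (D : BlowUpData) (n : ℤ) (θ : UnitAddCircle) :
    Measure UnitAddCircle :=
  Measure.map (fun x => x + n • D.ρ) (D.fibre₀ (θ - n • D.ω))

/-- The fibre measure `μ_θ = ∑ aₙ μⁿ_θ + b Leb`, with `b = 1 - ∑ aₙ`. -/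
noncomputable def fibre (D : BlowUpData) (θ : UnitAddCircle) : Measure UnitAddCircle :=
  Measure.sum (fun n : ℤ => ENNReal.ofReal (D.a n) • D.fibreIter n θ) +
    ENNReal.ofReal (1 - ∑' n, D.a n) • (volume : Measure UnitAddCircle)

end BlowUpData

end ReesTorus

namespace ReesTorus

/-! ### Factor maps onto rotations -/

section Dynamics

variable {X Y : Type*}

/-! The blown-up system is built abstractly and then identified with the torus. The distribution
function of `μ⁰_θ`, with its jump filled in, is a relation between positions and levels; it is a
closed relation because the quantile function `D.quant` is jointly continuous in `θ` and `t`. It is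
single-valued except at `D.point`, where the level ranges over an interval of length one. A point of
`D.space` is a torus point `z` together with one admissible level at each `z - n • D.vec`. This
space is compact, and `D.shift` lifts the rotation to it. By rational independence at most one level
is free, so the fibres of the projection to `z` are points off the orbit of `D.point` and intervals
on it.

Averaging the levels with weights `a n` gives `height`. On each vertical circle, `s + height - base`
is the distribution function of `μ_θ` with its jumps filled in, so `D.chart` is a continuous
bijection onto the torus (`injective_chart`, `surjective_chart`) and, by compactness, a
homeomorphism. Transporting `D.shift` gives `f`, and transporting the projection gives `h`, which
inverts the distribution functions and hence consists of quantile functions (`fibre_arc`,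
`isQuantile_factor`).

The dynamics follow from the fibres of `h`. Singleton fibres over an isometric minimal rotation
yield minimality, almost automorphy and distal points. A segment over the orbit has length `a n`,
and its iterates have lengths `a (n + k)`, which tend to zero, so its points are not distal. -/

theorem zpow_semiconj [TopologicalSpace X] [TopologicalSpace Y] {f : X ≃ₜ X} {g : Y ≃ₜ Y}
    {h : X → Y} (H : ∀ p, h (f p) = g (h p)) (n : ℤ) (p : X) :
    h ((f ^ n) p) = (g ^ n) (h p) := by
  have Hinv : ∀ p, h (f⁻¹ p) = g⁻¹ (h p) := fun p => by
    have h1 : g (h (f⁻¹ p)) = h p := by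
      rw [← H, ← Homeomorph.mul_apply, mul_inv_cancel, Homeomorph.one_apply]
    rw [← h1, ← Homeomorph.mul_apply, inv_mul_cancel, Homeomorph.one_apply]
  induction n using Int.induction_on generalizing p with
  | zero => simp
  | succ n ih => simp only [zpow_add_one, Homeomorph.mul_apply, ih, H]
  | pred n ih => simp only [zpow_sub_one, Homeomorph.mul_apply, ih, Hinv]

theorem addRight_zpow_apply [TopologicalSpace X] [AddCommGroup X] [IsTopologicalAddGroup X]
    (v z : X) (n : ℤ) : ((Homeomorph.addRight v) ^ n) z = z + n • v := by
  have Hinv : ∀ z, (Homeomorph.addRight v)⁻¹ z = z - v := fun z => by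
    have h1 : Homeomorph.addRight v ((Homeomorph.addRight v)⁻¹ z) = z := by
      rw [← Homeomorph.mul_apply, mul_inv_cancel, Homeomorph.one_apply]
    rw [Homeomorph.coe_addRight] at h1
    exact eq_sub_of_add_eq h1
  induction n using Int.induction_on generalizing z with
  | zero => simp
  | succ n ih =>
    simp only [zpow_add_one, Homeomorph.mul_apply, ih, Homeomorph.coe_addRight, add_zsmul,
      one_zsmul]
    abel
  | pred n ih =>
    simp only [zpow_sub_one, Homeomorph.mul_apply, ih, Hinv, sub_zsmul, one_zsmul]
    abel

theorem rotation_zpow_apply (ω ρ : UnitAddCircle) (z : Torus) (n : ℤ) :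
    ((rotation ω ρ) ^ n) z = z + n • ((ω, ρ) : Torus) :=
  addRight_zpow_apply _ _ _

/-- An almost one-to-one extension of a minimal homeomorphism is minimal. -/
theorem IsFactorMap.isMinimal [TopologicalSpace X] [CompactSpace X] [TopologicalSpace Y]
    [T2Space Y] {f : X ≃ₜ X} {g : Y ≃ₜ Y} {h : X → Y} (H : IsFactorMap f g h)
    (hg : IsMinimal g) {U : Set X} (hU : Dense U) (hinj : ∀ x ∈ U, ∀ y, h y = h x → y = x) :
    IsMinimal f := by
  intro x
  have hsub : U ⊆ closure (orbit f x) := by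
    intro u hu
    have hcl : IsClosed (h '' closure (orbit f x)) :=
      (isClosed_closure.isCompact.image H.1).isClosed
    have hor : orbit g (h x) ⊆ h '' closure (orbit f x) := by
      rintro _ ⟨n, rfl⟩
      exact ⟨(f ^ n) x, subset_closure ⟨n, rfl⟩, zpow_semiconj H.2.2 n x⟩
    have : h u ∈ h '' closure (orbit f x) := closure_minimal hor hcl (hg (h x) (h u))
    obtain ⟨y, hy, hyu⟩ := this
    exact hinj u hu y hyu ▸ hy
  exact dense_closure.1 (hU.mono hsub)

/-- Injectivity points of a factor map are points of continuity of its inverse relation. -/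
theorem tendsto_of_tendsto_image [TopologicalSpace X] [CompactSpace X] [TopologicalSpace Y]
    [T2Space Y] {h : X → Y} (hc : Continuous h) {x : X} (hinj : ∀ y, h y = h x → y = x)
    {u : ℕ → X} (hu : Tendsto (fun k => h (u k)) atTop (𝓝 (h x))) :
    Tendsto u atTop (𝓝 x) := by
  refine tendsto_nhds_of_unique_mapClusterPt fun y hy => hinj y ?_
  have h1 : MapClusterPt (h y) atTop (fun k => h (u k)) := hy.continuousAt_comp hc.continuousAt
  have h2 : ClusterPt (h y) (𝓝 (h x)) := ClusterPt.mono h1 hu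
  exact eq_of_nhds_neBot h2

end Dynamics

/-- In the rotation, convergence along `n k` forces the translations to converge to `h y - h x`, so
translating back from `h y` returns to `h x`; the singleton fibre lifts this convergence. -/
theorem IsFactorMap.isAlmostAutomorphic {X : Type*} [TopologicalSpace X] [CompactSpace X]
    {f : X ≃ₜ X} {ω ρ : UnitAddCircle} {h : X → Torus} (H : IsFactorMap f (rotation ω ρ) h)
    {x : X} (hinj : ∀ y, h y = h x → y = x) : IsAlmostAutomorphic f := by
  refine ⟨x, fun n y hy => tendsto_of_tendsto_image H.1 hinj ?_⟩
  have h1 := (H.1.tendsto y).comp hy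
  simp only [Function.comp_def, zpow_semiconj H.2.2, rotation_zpow_apply] at h1 ⊢
  have h2 := (tendsto_const_nhds (x := h y)).sub h1
  have h3 := h2.add (tendsto_const_nhds (x := h x))
  simp only [sub_self, zero_add] at h3
  refine h3.congr fun k => ?_
  rw [neg_zsmul]
  abel

/-- The rotation is an isometry, so the images stay at a fixed positive distance; uniform continuity
of `h` then keeps the orbits apart. -/
theorem IsFactorMap.isDistalPoint {X : Type*} [MetricSpace X] [CompactSpace X]
    {f : X ≃ₜ X} {ω ρ : UnitAddCircle} {h : X → Torus} (H : IsFactorMap f (rotation ω ρ) h)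
    {x : X} (hinj : ∀ y, h y = h x → y = x) : IsDistalPoint f x := by
  intro y hy
  have hne : h y ≠ h x := fun e => hy (hinj y e)
  have hpos : 0 < dist (h x) (h y) := dist_pos.2 hne.symm
  have huc := CompactSpace.uniformContinuous_of_continuous H.1
  obtain ⟨δ, hδ, hd⟩ := Metric.uniformContinuous_iff.1 huc _ hpos
  refine hδ.trans_le (le_ciInf fun n => ?_)
  by_contra! hlt
  have := hd hlt
  simp only [zpow_semiconj H.2.2, rotation_zpow_apply, dist_add_right, lt_irrefl] at this

theorem not_isDistalPoint {X : Type*} [MetricSpace X] {f : X ≃ₜ X} {x y : X} (hne : y ≠ x)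
    (hd : Tendsto (fun n : ℕ => dist ((f ^ (n : ℤ)) x) ((f ^ (n : ℤ)) y)) atTop (𝓝 0)) :
    ¬ IsDistalPoint f x := by
  intro hx
  obtain ⟨n, hn⟩ := (hd.eventually_lt_const (hx y hne)).exists
  exact hn.not_ge (ciInf_le ⟨0, by rintro _ ⟨n, rfl⟩; exact dist_nonneg⟩ (n : ℤ))

/-! ### Rotations with dense orbits -/

theorem norm_coe_le_abs (x : ℝ) : ‖(x : UnitAddCircle)‖ ≤ |x| := by
  rw [UnitAddCircle.norm_eq]
  simpa using round_le x 0

/-- The solutions of `n • s' = u` are spaced `1 / n` apart. -/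
theorem exists_dist_lt_nsmul_eq (s u : UnitAddCircle) {ε : ℝ} {n : ℕ} (hn : 0 < n)
    (hε : 1 < n * ε) : ∃ s', dist s' s < ε ∧ n • s' = u := by
  obtain ⟨s, rfl⟩ := QuotientAddGroup.mk_surjective s
  obtain ⟨u, rfl⟩ := QuotientAddGroup.mk_surjective u
  have hn' : (0 : ℝ) < n := by exact_mod_cast hn
  refine ⟨(((u + ⌊n * s - u⌋) / n : ℝ) : UnitAddCircle), ?_, ?_⟩
  · rw [dist_eq_norm]
    change ‖(((u + ⌊n * s - u⌋) / n : ℝ) : UnitAddCircle) - ((s : ℝ) : UnitAddCircle)‖ < ε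
    rw [← AddCircle.coe_sub]
    refine lt_of_le_of_lt (norm_coe_le_abs _) ?_
    rw [div_sub' hn'.ne', abs_div, abs_of_pos hn', div_lt_iff₀ hn', abs_lt]
    have h1 := Int.floor_le (n * s - u)
    have h2 := Int.lt_floor_add_one (n * s - u)
    constructor <;> nlinarith
  · rw [← AddCircle.coe_nsmul, nsmul_eq_mul, mul_div_cancel₀ _ hn'.ne']
    have : ((⌊n * s - u⌋ : ℝ) : UnitAddCircle) = 0 :=
      (AddCircle.coe_eq_zero_iff 1).2 ⟨⌊n * s - u⌋, by simp⟩
    rw [AddCircle.coe_add, this, add_zero]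

/-- Baire category: the vectors with some multiple in a given basic open set form a dense open set.
-/
theorem exists_dense_zmultiples : ∃ v : Torus, Dense (Set.range fun n : ℤ => n • v) := by
  obtain ⟨B, hBc, -, hB⟩ := TopologicalSpace.exists_countable_basis Torus
  have key : Dense (⋂ U : {U : Set Torus // U ∈ B ∧ U.Nonempty},
      {v : Torus | ∃ n : ℕ, n • v ∈ U.1}) := by
    have : Countable {U : Set Torus // U ∈ B ∧ U.Nonempty} :=
      (hBc.mono fun _ h => h.1 : ({U | U ∈ B ∧ U.Nonempty} : Set (Set Torus)).Countable).to_subtype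
    refine dense_iInter_of_isOpen (fun U => ?_) fun U => ?_
    · simp only [ofPred_exists]
      exact isOpen_iUnion fun n => (hB.isOpen U.2.1).preimage (continuous_const_smul n)
    · obtain ⟨u, hu⟩ := U.2.2
      refine Metric.dense_iff.2 fun v ε hε => ?_
      obtain ⟨n, hn⟩ := exists_nat_gt (1 / ε)
      have hn0 : 0 < n := by
        have : (0 : ℝ) < n := (by positivity : 0 < 1 / ε).trans hn
        exact_mod_cast this
      rw [div_lt_iff₀ hε] at hn
      obtain ⟨s, hs, hs'⟩ := exists_dist_lt_nsmul_eq v.1 u.1 hn0 hn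
      obtain ⟨t, ht, ht'⟩ := exists_dist_lt_nsmul_eq v.2 u.2 hn0 hn
      exact ⟨(s, t), by simp [Prod.dist_eq, hs, ht],
        n, by rwa [Prod.smul_mk, hs', ht']⟩
  obtain ⟨v, hv⟩ := key.nonempty
  refine ⟨v, hB.dense_iff.2 fun o ho hne => ?_⟩
  obtain ⟨n, hn⟩ := mem_iInter.1 hv ⟨o, ho, hne⟩
  exact ⟨n • v, hn, n, by simp⟩

theorem isMinimal_rotation {ω ρ : UnitAddCircle}
    (hd : Dense (Set.range fun n : ℤ => n • ((ω, ρ) : Torus))) : IsMinimal (rotation ω ρ) := by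
  intro z
  have h1 := (Homeomorph.addLeft z).surjective.denseRange.dense_image
    (Homeomorph.addLeft z).continuous hd
  rw [← range_comp] at h1
  have e : orbit (rotation ω ρ) z = _ :=
    congrArg range (funext fun n => rotation_zpow_apply ω ρ z n)
  rw [e]
  exact h1

/-- A character vanishing on a dense subgroup vanishes on the whole torus, hence is trivial. -/
theorem isIrrationalRotation_of_dense {ω ρ : UnitAddCircle}
    (hd : Dense (Set.range fun n : ℤ => n • ((ω, ρ) : Torus))) : IsIrrationalRotation ω ρ := by
  intro k l hkl
  have hall : ∀ z : Torus, k • z.1 + l • z.2 = 0 := by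
    have hcl : IsClosed {z : Torus | k • z.1 + l • z.2 = 0} :=
      isClosed_eq (by fun_prop) continuous_const
    have hsub : (Set.range fun n : ℤ => n • ((ω, ρ) : Torus)) ⊆
        {z : Torus | k • z.1 + l • z.2 = 0} := by
      rintro _ ⟨n, rfl⟩
      change k • n • ω + l • n • ρ = 0
      rw [smul_comm k n, smul_comm l n, ← smul_add, hkl, smul_zero]
    intro z
    exact closure_minimal hsub hcl (hd z)
  have hzero : ∀ m : ℤ, (∀ x : UnitAddCircle, m • x = 0) → m = 0 := by
    intro m hm
    by_contra hm0
    have hmR : (m : ℝ) ≠ 0 := by exact_mod_cast hm0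
    have h1 := hm (((1 / 2) / m : ℝ) : UnitAddCircle)
    rw [← AddCircle.coe_zsmul, zsmul_eq_mul, mul_div_cancel₀ _ hmR,
      AddCircle.coe_eq_zero_iff_of_mem_Ico ⟨by norm_num, by norm_num⟩] at h1
    norm_num at h1
  exact ⟨hzero k fun x => by simpa using hall (x, 0), hzero l fun x => by simpa using hall (0, x)⟩

theorem exists_blowUpData : ∃ D : BlowUpData, IsMinimal D.rot := by
  obtain ⟨⟨ω, ρ⟩, hd⟩ := exists_dense_zmultiples
  have hirr := isIrrationalRotation_of_dense hd
  obtain ⟨a, ha, c, hc, hc'⟩ := posSumOfEncodable (ε := 1 / 2) (by norm_num) ℤ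
  have hφ : ∀ x : ℝ, 0 ≤ x → (max 0 (3 / 8 - x)) / 2 ∈ Icc (0 : ℝ) (3 / 16) := fun x hx =>
    ⟨by positivity, by
      have : max 0 (3 / 8 - x) ≤ 3 / 8 := max_le (by norm_num) (by linarith)
      linarith⟩
  refine ⟨{
    ω := ω
    ρ := ρ
    irrational := hirr
    a := a
    a_pos := ha
    a_summable := hc.summable
    a_sum_lt_one := by rw [hc.tsum_eq]; linarith
    θs := 0
    γ := fun _ => 1 / 2
    -- The tents defining `ψ` and `φ` are supported on the arcs from `1/4` to `1` and from `0` to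
    -- `3/4`: each vanishes on its prescribed side of `0`, and together they are positive everywhere
    -- else.
    ψ := fun θ => 1 / 2 - (max 0 (3 / 8 - ‖θ - ((5 / 8 : ℝ) : UnitAddCircle)‖)) / 2
    φ := fun θ => 1 / 2 + (max 0 (3 / 8 - ‖θ - ((3 / 8 : ℝ) : UnitAddCircle)‖)) / 2
    γ_cont := continuous_const
    ψ_cont := by fun_prop
    φ_cont := by fun_prop
    γ_mem := fun _ => by norm_num
    ψ_mem := fun θ => ?_
    φ_mem := fun θ => ?_
    ψ_le := fun θ => ?_
    le_φ := fun θ => ?_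
    φ_left := ?_
    ψ_right := ?_
    ψ_lt_φ := fun θ hθ => ?_
    orbit_avoids := fun n hn => ?_ }, isMinimal_rotation hd⟩
  · have := hφ _ (norm_nonneg (θ - ((5 / 8 : ℝ) : UnitAddCircle)))
    constructor <;> linarith [this.1, this.2]
  · have := hφ _ (norm_nonneg (θ - ((3 / 8 : ℝ) : UnitAddCircle)))
    constructor <;> linarith [this.1, this.2]
  · have := hφ _ (norm_nonneg (θ - ((5 / 8 : ℝ) : UnitAddCircle)))
    linarith [this.1, this.2]
  · have := hφ _ (norm_nonneg (θ - ((3 / 8 : ℝ) : UnitAddCircle)))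
    linarith [this.1, this.2]
  · filter_upwards [self_mem_nhdsWithin, mem_nhdsWithin_of_mem_nhds (Ioi_mem_nhds
      (by norm_num : (-1 / 8 : ℝ) < 0))] with t ht ht'
    have ht : t ≤ 0 := ht
    have ht' : -1 / 8 < t := ht'
    rw [zero_add, ← AddCircle.coe_sub, (AddCircle.norm_coe_eq_abs_iff 1 one_ne_zero).2,
      abs_of_nonpos (by linarith), max_eq_left (by linarith)]
    · norm_num
    · rw [abs_of_nonpos (by linarith), abs_one]; linarith
  · filter_upwards [self_mem_nhdsWithin, mem_nhdsWithin_of_mem_nhds (Iio_mem_nhds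
      (by norm_num : (0 : ℝ) < 1 / 8))] with t ht ht'
    have ht : 0 ≤ t := ht
    have ht' : t < 1 / 8 := ht'
    have e : ((t : ℝ) : UnitAddCircle) - ((5 / 8 : ℝ) : UnitAddCircle) =
        ((t + 3 / 8 : ℝ) : UnitAddCircle) := by
      rw [← AddCircle.coe_sub, ← AddCircle.coe_add_period (1 : ℝ) (t - 5 / 8)]
      congr 1; ring
    rw [zero_add, e, (AddCircle.norm_coe_eq_abs_iff 1 one_ne_zero).2,
      abs_of_nonneg (by linarith), max_eq_left (by linarith)]
    · norm_num
    · rw [abs_of_nonneg (by linarith), abs_one]; linarith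
  · obtain ⟨t, ht, rfl⟩ := AddCircle.eq_coe_Ico θ
    have ht0 : 0 < t := lt_of_le_of_ne ht.1 fun e => hθ (by rw [← e]; rfl)
    have ht1 : t < 1 := ht.2
    have h1 : ∀ x : ℝ, |t - x| < 3 / 8 →
        0 < max 0 (3 / 8 - ‖((t : ℝ) : UnitAddCircle) - ((x : ℝ) : UnitAddCircle)‖) := by
      intro x hx
      refine lt_max_of_lt_right ?_
      rw [← AddCircle.coe_sub]
      have : ‖((t - x : ℝ) : UnitAddCircle)‖ ≤ |t - x| := norm_coe_le_abs _
      linarith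
    have hA := hφ _ (norm_nonneg (((t : ℝ) : UnitAddCircle) - ((3 / 8 : ℝ) : UnitAddCircle)))
    have hB := hφ _ (norm_nonneg (((t : ℝ) : UnitAddCircle) - ((5 / 8 : ℝ) : UnitAddCircle)))
    rcases lt_or_ge t (3 / 4) with h | h
    · have := h1 (3 / 8) (by rw [abs_lt]; constructor <;> linarith)
      linarith [hB.1]
    · have := h1 (5 / 8) (by rw [abs_lt]; constructor <;> linarith)
      linarith [hA.1]
  -- Doubling removes the constant `1/2`, and rational independence leaves only `n = 0`.
  · have h2 : (2 * n) • ρ = 0 := by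
      have h3 := congrArg (fun x => (2 : ℤ) • x) hn
      simp only [smul_add, smul_zero, smul_smul] at h3
      rwa [← AddCircle.coe_zsmul, (AddCircle.coe_eq_zero_iff 1).2 ⟨1, by norm_num⟩,
        zero_add] at h3
    have h4 := (hirr 0 (2 * n) (by simpa using h2)).2
    have h5 : n = 0 := by omega
    rw [h5, zero_zsmul, add_zero, AddCircle.coe_eq_zero_iff_of_mem_Ico
      ⟨by norm_num, by norm_num⟩] at hn
    norm_num at hn

/-! ### Levels of the fibre measures and their closed graph -/

namespace BlowUpData

variable (D : BlowUpData)

/-- The translation vector of the rotation. -/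
noncomputable def vec : Torus := (D.ω, D.ρ)

/-- The quantile function of `μ⁰_θ`. -/
noncomputable def quant (θ : UnitAddCircle) (t : ℝ) : ℝ := D.ψ θ + t * (D.φ θ - D.ψ θ)

/-- `t` lies between the left and the right limit at `s` of the distribution function of `μ⁰_θ`. -/
def IsLevel (θ : UnitAddCircle) (s t : ℝ) : Prop :=
  t ∈ Icc (0 : ℝ) 1 ∧ (t = 1 ∨ s ≤ D.quant θ t) ∧ (t = 0 ∨ D.quant θ t ≤ s)

/-- The closed graph of the (periodic) relation `s ↦ t - s`, where `t` is a level at `s`. -/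
def graph : Set (Torus × ℝ) :=
  (fun p : UnitAddCircle × ℝ × ℝ => ((p.1, (p.2.1 : UnitAddCircle)), p.2.2 - p.2.1)) ''
    {p | p.2.1 ∈ Icc (0 : ℝ) 1 ∧ D.IsLevel p.1 p.2.1 p.2.2}

variable {D}

theorem ψ_le_φ (θ : UnitAddCircle) : D.ψ θ ≤ D.φ θ := (D.ψ_le θ).trans (D.le_φ θ)

theorem φ_θs : D.φ D.θs = D.γ D.θs := by
  simpa using D.φ_left.self_of_nhdsWithin (mem_Iic.2 le_rfl)

theorem ψ_θs : D.ψ D.θs = D.γ D.θs := by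
  simpa using D.ψ_right.self_of_nhdsWithin (mem_Ici.2 le_rfl)

theorem quant_θs (t : ℝ) : D.quant D.θs t = D.γ D.θs := by
  simp [quant, φ_θs, ψ_θs]

theorem quant_mono (θ : UnitAddCircle) : Monotone (D.quant θ) := fun s t h => by
  have := mul_le_mul_of_nonneg_right h (sub_nonneg.2 (ψ_le_φ (D := D) θ))
  unfold quant
  linarith

theorem isCompact_graph : IsCompact D.graph := by
  have hψ := D.ψ_cont
  have hφ := D.φ_cont
  have hq : Continuous fun p : UnitAddCircle × ℝ × ℝ => D.quant p.1 p.2.2 := by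
    unfold quant; fun_prop
  refine IsCompact.image ?_ (by fun_prop)
  have hK : IsCompact ((univ : Set UnitAddCircle) ×ˢ (Icc (0 : ℝ) 1 ×ˢ Icc (0 : ℝ) 1)) :=
    isCompact_univ.prod (isCompact_Icc.prod isCompact_Icc)
  refine hK.of_isClosed_subset ?_ fun p hp => ⟨mem_univ _, hp.1, hp.2.1⟩
  refine (isClosed_Icc.preimage (by fun_prop : Continuous
    fun p : UnitAddCircle × ℝ × ℝ => p.2.1)).inter ?_
  refine (isClosed_Icc.preimage (by fun_prop : Continuous
    fun p : UnitAddCircle × ℝ × ℝ => p.2.2)).inter (IsClosed.inter ?_ ?_)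
  · exact (isClosed_eq (by fun_prop) continuous_const).union (isClosed_le (by fun_prop) hq)
  · exact (isClosed_eq (by fun_prop) continuous_const).union (isClosed_le hq (by fun_prop))

theorem IsLevel.eq_zero {θ : UnitAddCircle} {t : ℝ} (h : D.IsLevel θ 0 t) : t = 0 := by
  obtain ⟨ht, -, h | h⟩ := h
  · exact h
  · by_contra h0
    have ht0 : 0 < t := lt_of_le_of_ne ht.1 (Ne.symm h0)
    have h1 : 0 < t * D.φ θ := mul_pos ht0 ((D.γ_mem θ).1.trans_le (D.le_φ θ))
    have h2 : 0 ≤ (1 - t) * D.ψ θ := mul_nonneg (by linarith [ht.2]) (D.ψ_mem θ).1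
    unfold quant at h
    linarith

theorem IsLevel.eq_one {θ : UnitAddCircle} {t : ℝ} (h : D.IsLevel θ 1 t) : t = 1 := by
  obtain ⟨ht, h | h, -⟩ := h
  · exact h
  · by_contra h0
    have ht1 : t < 1 := lt_of_le_of_ne ht.2 h0
    have h1 : 0 < (1 - t) * (1 - D.ψ θ) :=
      mul_pos (by linarith) (by linarith [(D.γ_mem θ).2, D.ψ_le θ])
    have h2 : 0 ≤ t * (1 - D.φ θ) := mul_nonneg ht.1 (by linarith [(D.φ_mem θ).2])
    unfold quant at h
    linarith

theorem isLevel_zero (θ : UnitAddCircle) : D.IsLevel θ 0 0 :=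
  ⟨⟨le_rfl, zero_le_one⟩, Or.inr (by simpa [quant] using (D.ψ_mem θ).1), Or.inl rfl⟩

/-- The ends `s = 0` and `s = 1` glue consistently: their only levels are `0` and `1`, so `t - s`
vanishes at both. -/
theorem mem_graph_coe {θ : UnitAddCircle} {s u : ℝ} (hs : s ∈ Ico (0 : ℝ) 1) :
    ((θ, (s : UnitAddCircle)), u) ∈ D.graph ↔ D.IsLevel θ s (u + s) := by
  constructor
  · rintro ⟨⟨θ', s', t⟩, ⟨hs', hl⟩, he⟩
    simp only [Prod.mk.injEq] at he hs' hl
    obtain ⟨⟨rfl, h1⟩, rfl⟩ := he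
    rcases hs'.2.lt_or_eq with h | rfl
    · rw [AddCircle.coe_eq_coe_iff_of_mem_Ico (a := 0) (by simpa using ⟨hs'.1, h⟩)
        (by simpa using hs)] at h1
      subst h1
      simpa using hl
    · have h2 : s = 0 := by
        rw [← AddCircle.coe_eq_zero_iff_of_mem_Ico (p := (1 : ℝ)) hs, ← h1]
        exact AddCircle.coe_period 1
      subst h2
      simpa [hl.eq_one] using isLevel_zero θ'
  · intro h
    exact ⟨(θ, s, u + s), ⟨⟨hs.1, hs.2.le⟩, h⟩, by simp⟩

theorem IsLevel.mono {θ : UnitAddCircle} {s s' t t' : ℝ} (h : D.IsLevel θ s t)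
    (h' : D.IsLevel θ s' t') (hs : s < s') : t ≤ t' := by
  by_contra! hlt
  have h1 : D.quant θ t ≤ s := h.2.2.resolve_left (by linarith [h'.1.1])
  have h2 : s' ≤ D.quant θ t' := h'.2.1.resolve_left (by linarith [h.1.2])
  linarith [quant_mono (D := D) θ hlt.le]

/-- Two levels at one position make the affine quantile function constant, which happens only where
`ψ = φ`. -/
theorem IsLevel.eq_point {θ : UnitAddCircle} {s t t' : ℝ} (h : D.IsLevel θ s t)
    (h' : D.IsLevel θ s t') (ht : t < t') : θ = D.θs ∧ s = D.γ D.θs := by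
  have h1 : s ≤ D.quant θ t := h.2.1.resolve_left (by linarith [h'.1.2])
  have h2 : D.quant θ t' ≤ s := h'.2.2.resolve_left (by linarith [h.1.1])
  have h3 : D.quant θ t = D.quant θ t' :=
    le_antisymm (quant_mono θ ht.le) (h2.trans h1)
  have hθ : θ = D.θs := by
    by_contra hne
    have := mul_pos (sub_pos.2 ht) (sub_pos.2 (D.ψ_lt_φ θ hne))
    unfold quant at h3
    linarith
  subst hθ
  rw [quant_θs] at h1 h2
  exact ⟨rfl, le_antisymm h1 h2⟩

theorem isLevel_point {t : ℝ} (ht : t ∈ Icc (0 : ℝ) 1) : D.IsLevel D.θs (D.γ D.θs) t :=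
  ⟨ht, Or.inr (quant_θs t).ge, Or.inr (quant_θs t).le⟩

open Classical in
/-- The distribution function of `μ⁰_θ`. -/
noncomputable def cdf (D : BlowUpData) (θ : UnitAddCircle) (s : ℝ) : ℝ :=
  if θ = D.θs then (if D.γ θ ≤ s then 1 else 0)
  else max 0 ((min (D.φ θ) s - D.ψ θ) / (D.φ θ - D.ψ θ))

theorem isLevel_cdf (θ : UnitAddCircle) (s : ℝ) : D.IsLevel θ s (D.cdf θ s) := by
  unfold cdf
  split_ifs with h h'
  · subst h
    exact ⟨by simp, Or.inl rfl, Or.inr (by rwa [quant_θs])⟩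
  · subst h
    exact ⟨by simp, Or.inr (by rw [quant_θs]; exact (not_le.1 h').le), Or.inl rfl⟩
  · have hpos : 0 < D.φ θ - D.ψ θ := sub_pos.2 (D.ψ_lt_φ θ h)
    rcases le_total (D.φ θ) s with h1 | h1
    · rw [min_eq_left h1, div_self hpos.ne', max_eq_right zero_le_one]
      exact ⟨by simp, Or.inl rfl, Or.inr (by simpa [quant] using h1)⟩
    rw [min_eq_right h1]
    rcases le_total s (D.ψ θ) with h2 | h2
    · rw [max_eq_left (div_nonpos_of_nonpos_of_nonneg (by linarith) hpos.le)]
      exact ⟨by simp, Or.inr (by simpa [quant] using h2), Or.inl rfl⟩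
    · rw [max_eq_right (div_nonneg (by linarith) hpos.le)]
      have : D.quant θ ((s - D.ψ θ) / (D.φ θ - D.ψ θ)) = s := by
        unfold quant
        rw [div_mul_cancel₀ _ hpos.ne']
        ring
      exact ⟨⟨div_nonneg (by linarith) hpos.le, (div_le_one hpos).2 (by linarith)⟩,
        Or.inr this.ge, Or.inr this.le⟩

theorem IsLevel.le_cdf {θ : UnitAddCircle} {s t : ℝ} (h : D.IsLevel θ s t) : t ≤ D.cdf θ s := by
  by_contra! hlt
  obtain ⟨rfl, rfl⟩ := (isLevel_cdf θ s).eq_point h hlt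
  have : D.cdf D.θs (D.γ D.θs) = 1 := by simp [cdf]
  linarith [h.1.2]

theorem cdf_eq_zero {θ : UnitAddCircle} {s : ℝ} (hs : s ≤ 0) : D.cdf θ s = 0 := by
  refine le_antisymm ?_ (isLevel_cdf θ s).1.1
  rcases hs.lt_or_eq with h | rfl
  · exact (isLevel_cdf θ s).mono (isLevel_zero θ) h
  · exact (isLevel_cdf θ 0).eq_zero.le

theorem cdf_eq_one {θ : UnitAddCircle} {s : ℝ} (hs : 1 ≤ s) : D.cdf θ s = 1 := by
  refine le_antisymm (isLevel_cdf θ s).1.2 ?_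
  rcases hs.lt_or_eq with h | rfl
  · exact (isLevel_cdf θ 1).eq_one.ge.trans ((isLevel_cdf θ 1).mono (isLevel_cdf θ s) h)
  · exact (isLevel_cdf θ 1).eq_one.ge

/-- The maximal selection of the relation `graph`. -/
noncomputable def top (D : BlowUpData) (z : Torus) : ℝ :=
  D.cdf z.1 (AddCircle.equivIco 1 0 z.2 : ℝ) - (AddCircle.equivIco 1 0 z.2 : ℝ)

theorem top_coe {θ : UnitAddCircle} {s : ℝ} (hs : s ∈ Ico (0 : ℝ) 1) :
    D.top (θ, (s : UnitAddCircle)) = D.cdf θ s - s := by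
  have : (AddCircle.equivIco 1 0 (s : UnitAddCircle) : ℝ) = s := by
    rw [AddCircle.equivIco_coe_eq (by simpa using hs)]
  simp only [top, this]

theorem mem_graph_top (z : Torus) : (z, D.top z) ∈ D.graph := by
  obtain ⟨θ, y⟩ := z
  obtain ⟨s, hs, rfl⟩ := AddCircle.eq_coe_Ico y
  rw [mem_graph_coe hs, top_coe hs, sub_add_cancel]
  exact isLevel_cdf θ s

theorem le_top {z : Torus} {u : ℝ} (h : (z, u) ∈ D.graph) : u ≤ D.top z := by
  obtain ⟨θ, y⟩ := z
  obtain ⟨s, hs, rfl⟩ := AddCircle.eq_coe_Ico y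
  rw [mem_graph_coe hs] at h
  rw [top_coe hs]
  linarith [h.le_cdf]

theorem abs_sub_le_of_mem_graph {z : Torus} {u u' : ℝ} (h : (z, u) ∈ D.graph)
    (h' : (z, u') ∈ D.graph) : |u - u'| ≤ 1 := by
  obtain ⟨θ, y⟩ := z
  obtain ⟨s, hs, rfl⟩ := AddCircle.eq_coe_Ico y
  rw [mem_graph_coe hs] at h h'
  rw [abs_le]
  constructor <;> linarith [h.1.1, h.1.2, h'.1.1, h'.1.2]

theorem mem_Icc_of_mem_graph {z : Torus} {u : ℝ} (h : (z, u) ∈ D.graph) :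
    u ∈ Icc (-1 : ℝ) 1 := by
  obtain ⟨θ, y⟩ := z
  obtain ⟨s, hs, rfl⟩ := AddCircle.eq_coe_Ico y
  rw [mem_graph_coe hs] at h
  constructor <;> linarith [h.1.1, h.1.2, hs.1, hs.2]

theorem eq_of_mem_graph {z : Torus} (hz : z ≠ D.point) {u u' : ℝ} (h : (z, u) ∈ D.graph)
    (h' : (z, u') ∈ D.graph) : u = u' := by
  obtain ⟨θ, y⟩ := z
  obtain ⟨s, hs, rfl⟩ := AddCircle.eq_coe_Ico y
  rw [mem_graph_coe hs] at h h'
  by_contra hne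
  apply hz
  rcases lt_or_gt_of_ne hne with hlt | hlt
  · obtain ⟨rfl, rfl⟩ := h.eq_point h' (by linarith)
    rfl
  · obtain ⟨rfl, rfl⟩ := h'.eq_point h (by linarith)
    rfl

theorem top_point : D.top D.point = 1 - D.γ D.θs := by
  have : D.γ D.θs ∈ Ico (0 : ℝ) 1 := ⟨(D.γ_mem _).1.le, (D.γ_mem _).2⟩
  rw [point, top_coe this]
  simp [cdf]

theorem mem_graph_point {u : ℝ} :
    (D.point, u) ∈ D.graph ↔ u ∈ Icc (D.top D.point - 1) (D.top D.point) := by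
  have : D.γ D.θs ∈ Ico (0 : ℝ) 1 := ⟨(D.γ_mem _).1.le, (D.γ_mem _).2⟩
  rw [top_point, point, mem_graph_coe this]
  constructor
  · intro h
    constructor <;> linarith [h.1.1, h.1.2]
  · intro h
    exact isLevel_point ⟨by linarith [h.1], by linarith [h.2]⟩

/-- On the real line, `s ↦ s + u` is the filled-in distribution function extended as a monotone
relation of degree one. The two cases are whether or not `s'` reaches the next integer after `s`. -/
theorem graph_mono {θ : UnitAddCircle} {s s' u u' : ℝ}
    (h : ((θ, (s : UnitAddCircle)), u) ∈ D.graph) (h' : ((θ, (s' : UnitAddCircle)), u') ∈ D.graph)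
    (hlt : s < s') (hlt' : s' < s + 1) : s + u ≤ s' + u' ∧ s' + u' ≤ s + u + 1 := by
  have hper : ∀ (x : ℝ) (k : ℤ), ((x - k : ℝ) : UnitAddCircle) = x := fun x k => by
    rw [AddCircle.coe_sub, (AddCircle.coe_eq_zero_iff 1 (x := (k : ℝ))).2 ⟨k, by simp⟩, sub_zero]
  rw [← hper s ⌊s⌋] at h
  have h1 := Int.floor_le s
  have h2 := Int.lt_floor_add_one s
  rw [mem_graph_coe ⟨by linarith, by linarith⟩] at h
  rcases lt_or_ge s' (⌊s⌋ + 1) with hc | hc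
  · rw [← hper s' ⌊s⌋, mem_graph_coe ⟨by linarith, by linarith⟩] at h'
    have := h.mono h' (by linarith)
    constructor <;> linarith [h.1.1, h'.1.2]
  · rw [← hper s' (⌊s⌋ + 1), mem_graph_coe (by push_cast; constructor <;> linarith)] at h'
    have := h'.mono h (by push_cast; linarith)
    have h3 := h'.1.1
    push_cast at this h3
    constructor <;> linarith [h.1.2]

/-- A function into a compact interval with closed graph is continuous; off `D.point` the graph is
single-valued. -/
theorem continuous_top_comp {Y : Type*} [TopologicalSpace Y] {g : Y → Torus} (hg : Continuous g)
    (hne : ∀ y, g y ≠ D.point) : Continuous fun y => D.top (g y) := by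
  let F : Y → Icc (-1 : ℝ) 1 := fun y => ⟨D.top (g y), mem_Icc_of_mem_graph (mem_graph_top _)⟩
  have hF : Continuous F := by
    refine continuous_iff_isClosed.2 fun s hs => ?_
    have hcl : IsClosed {p : Y × Icc (-1 : ℝ) 1 | (g p.1, (p.2 : ℝ)) ∈ D.graph ∧ p.2 ∈ s} :=
      (isCompact_graph.isClosed.preimage (by fun_prop)).inter (hs.preimage continuous_snd)
    convert isClosedMap_fst_of_compactSpace _ hcl using 1
    ext y
    constructor
    · intro hy
      exact ⟨(y, F y), ⟨mem_graph_top _, hy⟩, rfl⟩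
    · rintro ⟨⟨y, u⟩, ⟨hu, hus⟩, rfl⟩
      have : F y = u := Subtype.ext (eq_of_mem_graph (hne y) (mem_graph_top _) hu)
      rwa [mem_preimage, this]
  exact continuous_subtype_val.comp hF

/-! ### The blown up space -/

/-- The blown up torus: every point of the torus, together with its levels along the orbit. -/
def space (D : BlowUpData) : Set (Torus × (ℤ → ℝ)) :=
  {p | ∀ n : ℤ, (p.1 - n • D.vec, p.2 n) ∈ D.graph}

theorem isCompact_space : IsCompact D.space := by
  have hK : IsCompact ((univ : Set Torus) ×ˢ (univ.pi fun _ : ℤ => Icc (-1 : ℝ) 1)) :=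
    isCompact_univ.prod (isCompact_univ_pi fun _ => isCompact_Icc)
  refine hK.of_isClosed_subset ?_ fun p hp =>
    ⟨mem_univ _, fun n _ => mem_Icc_of_mem_graph (hp n)⟩
  have : D.space = ⋂ n : ℤ, {p | (p.1 - n • D.vec, p.2 n) ∈ D.graph} := by
    ext p; simp [space]
  rw [this]
  exact isClosed_iInter fun n => isCompact_graph.isClosed.preimage (by fun_prop)

instance : CompactSpace D.space := isCompact_iff_compactSpace.1 isCompact_space

/-- The maximal point of the blown up torus over a point of the torus. -/
noncomputable def lift (D : BlowUpData) (z : Torus) : D.space :=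
  ⟨(z, fun n => D.top (z - n • D.vec)), fun _ => mem_graph_top _⟩

/-- The rotation, lifted to the blown up torus. -/
noncomputable def shift (D : BlowUpData) : D.space ≃ₜ D.space where
  toFun p := ⟨(p.1.1 + D.vec, fun n => p.1.2 (n - 1)), fun n => by
    have := p.2 (n - 1)
    rwa [sub_zsmul, one_zsmul, ← sub_eq_add_neg, ← sub_add, sub_add_eq_add_sub] at this⟩
  invFun p := ⟨(p.1.1 - D.vec, fun n => p.1.2 (n + 1)), fun n => by
    have := p.2 (n + 1)
    rwa [add_zsmul, one_zsmul, sub_add_eq_sub_sub_swap] at this⟩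
  left_inv p := by ext <;> simp
  right_inv p := by ext <;> simp
  continuous_toFun := by fun_prop
  continuous_invFun := by fun_prop

/-- The weighted sum of the levels. -/
noncomputable def height (D : BlowUpData) (p : D.space) : ℝ := ∑' n, D.a n * p.1.2 n

theorem norm_mul_le (p : D.space) (n : ℤ) : ‖D.a n * p.1.2 n‖ ≤ D.a n := by
  have h := mem_Icc_of_mem_graph (p.2 n)
  rw [norm_mul, Real.norm_of_nonneg (D.a_pos n).le]
  exact mul_le_of_le_one_right (D.a_pos n).le (abs_le.2 h)

theorem summable_height (p : D.space) : Summable fun n => D.a n * p.1.2 n :=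
  D.a_summable.of_norm_bounded (norm_mul_le p)

theorem continuous_height : Continuous D.height :=
  continuous_tsum (fun n => by fun_prop) D.a_summable fun n p => norm_mul_le p n

theorem continuous_height_lift {Y : Type*} [TopologicalSpace Y] {g : Y → Torus}
    (hg : Continuous g) (hne : ∀ y (n : ℤ), g y - n • D.vec ≠ D.point) :
    Continuous fun y => D.height (D.lift (g y)) :=
  continuous_tsum (fun n => continuous_const.mul
    (continuous_top_comp (g := fun y => g y - n • D.vec) (by fun_prop) fun y => hne y n))
    D.a_summable fun n y => norm_mul_le (D.lift (g y)) n

/-- The zero section is never blown up, so `base` is continuous and can serve to normalise `chart`.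
-/
theorem sub_zsmul_ne_point (θ : UnitAddCircle) (n : ℤ) :
    (θ, (0 : UnitAddCircle)) - n • D.vec ≠ D.point := by
  intro h
  have h2 := congrArg Prod.snd h
  simp only [Prod.snd_sub, vec, Prod.smul_snd, point] at h2
  exact D.orbit_avoids n (by rw [← h2]; abel)

theorem level_mono {p p' : D.space} {θ : UnitAddCircle} {s s' : ℝ}
    (hp : p.1.1 = (θ, (s : UnitAddCircle))) (hp' : p'.1.1 = (θ, (s' : UnitAddCircle)))
    (hlt : s < s') (hlt' : s' < s + 1) (n : ℤ) :
    0 ≤ p'.1.2 n - p.1.2 n + (s' - s) ∧ p'.1.2 n - p.1.2 n + (s' - s) ≤ 1 := by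
  obtain ⟨r, hr⟩ := QuotientAddGroup.mk_surjective D.ρ
  have e : ∀ x : ℝ, ((θ, (x : UnitAddCircle)) : Torus) - n • D.vec =
      (θ - n • D.ω, ((x - n • r : ℝ) : UnitAddCircle)) := fun x => by
    have : ((r : ℝ) : UnitAddCircle) = D.ρ := hr
    rw [AddCircle.coe_sub, AddCircle.coe_zsmul, this]
    rfl
  have h := p.2 n
  have h' := p'.2 n
  rw [hp, e] at h
  rw [hp', e] at h'
  have := graph_mono h h' (by linarith) (by linarith)
  constructor <;> linarith [this.1, this.2]

theorem height_lt {p p' : D.space} {θ : UnitAddCircle} {s s' : ℝ}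
    (hp : p.1.1 = (θ, (s : UnitAddCircle))) (hp' : p'.1.1 = (θ, (s' : UnitAddCircle)))
    (hlt : s < s') (hlt' : s' < s + 1) :
    s + D.height p < s' + D.height p' ∧ s' + D.height p' < s + D.height p + 1 := by
  have key := level_mono hp hp' hlt hlt'
  have hs : Summable fun n => D.a n * (p'.1.2 n - p.1.2 n + (s' - s)) := by
    simpa only [mul_add, mul_sub] using ((summable_height p').sub (summable_height p)).add
      (((D.a_summable.mul_right s').sub (D.a_summable.mul_right s)))
  have hsum : ∑' n, D.a n * (p'.1.2 n - p.1.2 n + (s' - s)) =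
      D.height p' - D.height p + (∑' n, D.a n) * (s' - s) := by
    simp only [mul_add, mul_sub (D.a _) (p'.1.2 _)]
    rw [((summable_height p').sub (summable_height p)).tsum_add (D.a_summable.mul_right _),
      (summable_height p').tsum_sub (summable_height p), tsum_mul_right]
    rfl
  have h0 : 0 ≤ ∑' n, D.a n * (p'.1.2 n - p.1.2 n + (s' - s)) :=
    tsum_nonneg fun n => mul_nonneg (D.a_pos n).le (key n).1
  have h1 : ∑' n, D.a n * (p'.1.2 n - p.1.2 n + (s' - s)) ≤ ∑' n, D.a n :=
    hs.tsum_le_tsum (fun n => mul_le_of_le_one_right (D.a_pos n).le (key n).2) D.a_summable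
  rw [hsum] at h0 h1
  -- The Lebesgue part, of weight `1 - ∑ a n > 0`, makes both inequalities strict.
  have h2 := mul_pos (sub_pos.2 D.a_sum_lt_one) (sub_pos.2 hlt)
  have h3 := mul_pos (sub_pos.2 D.a_sum_lt_one) (sub_pos.2 hlt')
  constructor <;> nlinarith

theorem sub_zsmul_eq_point_unique {z : Torus} {m n : ℤ} (hm : z - m • D.vec = D.point)
    (hn : z - n • D.vec = D.point) : m = n := by
  have h1 : (m - n) • D.vec = 0 := by
    rw [sub_zsmul, ← sub_eq_add_neg, sub_eq_zero]
    exact sub_right_injective (hm.trans hn.symm)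
  have h2 := D.irrational (m - n) 0
    (by simpa [vec] using congrArg Prod.fst h1)
  omega

theorem level_eq {p p' : D.space} (hz : p.1.1 = p'.1.1) {n : ℤ}
    (hn : p.1.1 - n • D.vec ≠ D.point) : p.1.2 n = p'.1.2 n :=
  eq_of_mem_graph hn (p.2 n) (hz ▸ p'.2 n)

theorem eq_of_fst_eq {p p' : D.space} (hz : p.1.1 = p'.1.1)
    (hn : ∀ n : ℤ, p.1.1 - n • D.vec ≠ D.point) : p = p' :=
  Subtype.ext (Prod.ext hz (funext fun n => level_eq hz (hn n)))

theorem height_sub {p p' : D.space} (hz : p.1.1 = p'.1.1) {n : ℤ}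
    (hn : p.1.1 - n • D.vec = D.point) :
    D.height p - D.height p' = D.a n * (p.1.2 n - p'.1.2 n) := by
  rw [height, height, ← (summable_height p).tsum_sub (summable_height p'),
    tsum_eq_single n fun m hm => ?_, mul_sub]
  rw [level_eq hz fun h => hm (sub_zsmul_eq_point_unique h hn), sub_self]

theorem a_lt_one (n : ℤ) : D.a n < 1 :=
  (D.a_summable.le_tsum n fun m _ => (D.a_pos m).le).trans_lt D.a_sum_lt_one

/-- The height over the zero section. -/
noncomputable def base (D : BlowUpData) (θ : UnitAddCircle) : ℝ := D.height (D.lift (θ, 0))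

theorem continuous_base : Continuous D.base :=
  continuous_height_lift (g := fun θ => (θ, (0 : UnitAddCircle))) (by fun_prop) sub_zsmul_ne_point

theorem height_eq_base {p : D.space} {θ : UnitAddCircle} (hp : p.1.1 = (θ, 0)) :
    D.height p = D.base θ := by
  rw [base, eq_of_fst_eq (p := p) (p' := D.lift (θ, 0)) hp fun n => hp ▸ sub_zsmul_ne_point θ n]

/-- The identification of the blown up torus with the torus. -/
noncomputable def chart (D : BlowUpData) (p : D.space) : Torus :=
  (p.1.1.1, p.1.1.2 + ((D.height p - D.base p.1.1.1 : ℝ) : UnitAddCircle))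

theorem continuous_chart : Continuous D.chart := by
  have h1 := continuous_height (D := D)
  have h2 := continuous_base (D := D)
  have h3 : Continuous ((↑) : ℝ → UnitAddCircle) := AddCircle.continuous_mk' 1
  unfold chart
  fun_prop

theorem chart_coe {p : D.space} {θ : UnitAddCircle} {s : ℝ}
    (hp : p.1.1 = (θ, (s : UnitAddCircle))) :
    D.chart p = (θ, ((s + D.height p - D.base θ : ℝ) : UnitAddCircle)) := by
  rw [chart, hp, ← AddCircle.coe_add, add_sub_assoc]

theorem coe_ne_coe {x x' : ℝ} (h : x < x') (h' : x' < x + 1) :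
    (x : UnitAddCircle) ≠ (x' : UnitAddCircle) := fun he => by
  have := (AddCircle.coe_eq_coe_iff_of_mem_Ico (p := (1 : ℝ)) (a := x) ⟨le_rfl, by linarith⟩
    ⟨h.le, h'⟩).1 he
  linarith

/-- Different positions on a circle are separated by `height_lt`. Over one position only the level
at a single `n` can vary, and it changes the height by at most `a n < 1`, so equality modulo `1` is
equality. -/
theorem injective_chart : Function.Injective D.chart := by
  intro p p' he
  obtain ⟨s, hs, hs'⟩ := AddCircle.eq_coe_Ico p.1.1.2
  obtain ⟨r, hr, hr'⟩ := AddCircle.eq_coe_Ico p'.1.1.2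
  have hp : p.1.1 = (p.1.1.1, (s : UnitAddCircle)) := Prod.ext rfl hs'.symm
  have hθ : p.1.1.1 = p'.1.1.1 := by
    change (D.chart p).1 = (D.chart p').1
    rw [he]
  have hp' : p'.1.1 = (p.1.1.1, (r : UnitAddCircle)) := Prod.ext hθ.symm hr'.symm
  rw [chart_coe hp, chart_coe hp'] at he
  have he2 := congrArg Prod.snd he
  rcases lt_trichotomy s r with h | h | h
  · have := height_lt hp hp' h (by linarith [hs.1, hr.2])
    exact absurd he2 (coe_ne_coe (by linarith [this.1]) (by linarith [this.2]))
  · subst h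
    have hz : p.1.1 = p'.1.1 := hp.trans hp'.symm
    by_cases hn : ∀ n : ℤ, p.1.1 - n • D.vec ≠ D.point
    · exact eq_of_fst_eq hz hn
    push Not at hn
    obtain ⟨n, hn⟩ := hn
    have hsub := height_sub hz hn
    have hle := abs_sub_le_of_mem_graph (p.2 n) (hz ▸ p'.2 n)
    have hpos := D.a_pos n
    have habs : |D.height p - D.height p'| < 1 := by
      rw [hsub, abs_mul, abs_of_pos hpos]
      exact (mul_le_of_le_one_right hpos.le hle).trans_lt (a_lt_one n)
    have heq : D.height p = D.height p' := by
      rw [abs_lt] at habs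
      by_contra hne
      rcases lt_or_gt_of_ne hne with h | h
      · exact coe_ne_coe (by linarith) (by linarith) he2
      · exact coe_ne_coe (by linarith) (by linarith) he2.symm
    rw [heq, sub_self, eq_comm, mul_eq_zero, sub_eq_zero] at hsub
    have hlev : p.1.2 n = p'.1.2 n := hsub.resolve_left hpos.ne'
    refine Subtype.ext (Prod.ext hz (funext fun m => ?_))
    by_cases hm : m = n
    · rw [hm, hlev]
    · exact level_eq hz fun h => hm (sub_zsmul_eq_point_unique h hn)
  · have := height_lt hp' hp h (by linarith [hr.1, hs.2])
    exact absurd he2.symm (coe_ne_coe (by linarith [this.1]) (by linarith [this.2]))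

/-- Only countably many vertical circles are excluded. -/
theorem dense_regular : Dense {z : Torus | ∀ n : ℤ, z.1 - n • D.ω ≠ D.θs} := by
  have hc : (((↑) : ℝ → UnitAddCircle) ⁻¹'
      (Set.range fun n : ℤ => D.θs + n • D.ω)).Countable := by
    obtain ⟨t, ht⟩ := QuotientAddGroup.mk_surjective D.θs
    obtain ⟨w, hw⟩ := QuotientAddGroup.mk_surjective D.ω
    refine (countable_range fun p : ℤ × ℤ => t + p.1 • w + p.2 • (1 : ℝ)).mono ?_
    rintro x ⟨n, hn⟩
    have h1 : ((x - (t + n • w) : ℝ) : UnitAddCircle) = 0 := by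
      rw [AddCircle.coe_sub, AddCircle.coe_add, AddCircle.coe_zsmul, sub_eq_zero, ← hn]
      exact congrArg₂ (· + n • ·) ht.symm hw.symm
    obtain ⟨m, hm⟩ := (AddCircle.coe_eq_zero_iff 1).1 h1
    exact ⟨(n, m), by simp only [hm]; ring⟩
  have h1 : Dense (Set.range fun n : ℤ => D.θs + n • D.ω)ᶜ := by
    have h2 := (QuotientAddGroup.mk_surjective
      (s := AddSubgroup.zmultiples (1 : ℝ))).denseRange.dense_image
      (AddCircle.continuous_mk' (1 : ℝ)) (hc.dense_compl ℝ)
    refine h2.mono ?_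
    rintro _ ⟨x, hx, rfl⟩
    exact hx
  have h3 := h1.prod (dense_univ (X := UnitAddCircle))
  refine h3.mono ?_
  rintro z ⟨hz, -⟩ n h
  exact hz ⟨n, by rw [← h]; simp⟩

/-- The range is compact, so the dense set of regular circles suffices. There the distribution
function is continuous and runs from `0` to `1`, and the intermediate value theorem applies. -/
theorem surjective_chart : Function.Surjective D.chart := by
  have hcl : IsClosed (Set.range D.chart) := (isCompact_range continuous_chart).isClosed
  rw [← Set.range_eq_univ, ← hcl.closure_eq, ← dense_iff_closure_eq]
  refine (dense_regular (D := D)).mono ?_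
  rintro ⟨θ, x⟩ hθ
  obtain ⟨x, hx, rfl⟩ := AddCircle.eq_coe_Ico x
  let F : ℝ → ℝ := fun s => s + D.height (D.lift (θ, (s : UnitAddCircle))) - D.base θ
  have hF : Continuous F := by
    have : Continuous fun s : ℝ => D.height (D.lift (θ, (s : UnitAddCircle))) := by
      have h3 : Continuous ((↑) : ℝ → UnitAddCircle) := AddCircle.continuous_mk' 1
      refine continuous_height_lift (g := fun s : ℝ => (θ, (s : UnitAddCircle))) (by fun_prop) ?_
      intro s n h
      exact hθ n (congrArg Prod.fst h)
    fun_prop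
  have h0 : F 0 = 0 := by
    simp only [F, AddCircle.coe_zero]
    rw [height_eq_base (p := D.lift (θ, 0)) rfl]
    ring
  have h1 : F 1 = 1 := by
    simp only [F, AddCircle.coe_period]
    rw [height_eq_base (p := D.lift (θ, 0)) rfl]
    ring
  obtain ⟨s, -, hs⟩ := intermediate_value_Icc zero_le_one hF.continuousOn
    (show x ∈ Icc (F 0) (F 1) from ⟨by linarith [hx.1], by linarith [hx.2]⟩)
  exact ⟨D.lift (θ, (s : UnitAddCircle)), by rw [chart_coe (s := s) rfl, ← hs]⟩

/-- The blown up torus is a torus. -/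
noncomputable def chartHomeo (D : BlowUpData) : D.space ≃ₜ Torus :=
  Continuous.homeoOfEquivCompactToT2
    (f := Equiv.ofBijective D.chart ⟨injective_chart, surjective_chart⟩) continuous_chart

theorem chartHomeo_apply (p : D.space) : D.chartHomeo p = D.chart p := rfl

end BlowUpData

/-! ### Measures of arcs -/

theorem measurableSet_arc (c d : ℝ) :
    MeasurableSet ((fun t : ℝ => (t : UnitAddCircle)) '' Icc c d) :=
  (isCompact_Icc.image (AddCircle.continuous_mk' 1)).measurableSet

theorem measurable_coe_circle : Measurable fun t : ℝ => (t : UnitAddCircle) :=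
  (AddCircle.continuous_mk' 1).measurable

/-- An arc that may wrap past `0` meets the unit interval only in `[r, r + y]` and in its translate
by `-1`. -/
theorem map_coe_arc {ν : Measure ℝ} (hν : ν (Ioo 0 1)ᶜ = 0) {r y : ℝ} (hr : r ∈ Ico (0 : ℝ) 1)
    (hy : y ∈ Ico (0 : ℝ) 1) :
    Measure.map (fun t : ℝ => (t : UnitAddCircle)) ν
      ((fun t : ℝ => (t : UnitAddCircle)) '' Icc r (r + y)) =
      ν (Icc r (r + y)) + ν (Icc (r - 1) (r - 1 + y)) := by
  rw [Measure.map_apply measurable_coe_circle (measurableSet_arc _ _),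
    ← measure_union (Set.disjoint_left.2 fun x hx hx' => by linarith [hx.1, hx'.2, hy.2])
      measurableSet_Icc]
  refine measure_congr ?_
  filter_upwards [show ∀ᵐ x ∂ν, x ∈ Ioo (0 : ℝ) 1 from hν] with x hx
  refine propext ⟨?_, ?_⟩
  · rintro ⟨x', hx', he⟩
    have he : ((x' - x : ℝ) : UnitAddCircle) = 0 := by
      rw [AddCircle.coe_sub, sub_eq_zero]; exact he
    obtain ⟨m, hm⟩ := (AddCircle.coe_eq_zero_iff 1).1 he
    rw [zsmul_eq_mul, mul_one] at hm
    have h1 : (-1 : ℝ) < m := by rw [hm]; linarith [hx'.1, hr.1, hx.2]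
    have h2 : (m : ℝ) < 2 := by rw [hm]; linarith [hx'.2, hr.2, hy.2, hx.1]
    have h1 : (-1 : ℤ) < m := by exact_mod_cast h1
    have h2 : m < (2 : ℤ) := by exact_mod_cast h2
    obtain rfl | rfl : m = 0 ∨ m = 1 := by omega
    · have : x = x' := by push_cast at hm; linarith
      exact Or.inl (this ▸ hx')
    · push_cast at hm
      exact Or.inr ⟨by linarith [hx'.1], by linarith [hx'.2]⟩
  · rintro (h | h)
    · exact ⟨x, h, rfl⟩
    · exact ⟨x + 1, ⟨by linarith [h.1], by linarith [h.2]⟩, AddCircle.coe_add_period 1 x⟩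

theorem volume_arc {y : ℝ} (hy : y ∈ Ico (0 : ℝ) 1) :
    (volume : Measure UnitAddCircle) ((fun t : ℝ => (t : UnitAddCircle)) '' Icc 0 y) =
      ENNReal.ofReal y := by
  rw [← (UnitAddCircle.measurePreserving_mk 0).map_eq, zero_add]
  have h0 : (volume : Measure ℝ).restrict (Ioc 0 1) (Ioo 0 1)ᶜ = 0 := by
    rw [← restrict_Ioo_eq_restrict_Ioc, Measure.restrict_apply measurableSet_Ioo.compl]
    simp
  have := map_coe_arc h0 (r := 0) (by norm_num) hy
  simp only [zero_add, zero_sub] at this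
  rw [this, Measure.restrict_apply measurableSet_Icc, Measure.restrict_apply measurableSet_Icc]
  have h1 : Icc 0 y ∩ Ioc 0 1 = Ioc 0 y := by
    ext x
    simp only [mem_inter_iff, mem_Icc, mem_Ioc]
    constructor
    · rintro ⟨⟨-, h⟩, h', -⟩; exact ⟨h', h⟩
    · rintro ⟨h, h'⟩; exact ⟨⟨h.le, h'⟩, h, h'.trans hy.2.le⟩
  have h2 : Icc (-1) (-1 + y) ∩ Ioc 0 1 = ∅ := by
    ext x
    simp only [mem_inter_iff, mem_Icc, mem_Ioc, mem_empty_iff_false, iff_false]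
    rintro ⟨⟨-, h⟩, h', -⟩
    linarith [hy.2]
  rw [h1, h2, Real.volume_Ioc, measure_empty, add_zero, sub_zero]

namespace BlowUpData

variable {D : BlowUpData}

open Classical in
/-- The measure `μ⁰_θ` on the unit interval. -/
noncomputable def realFibre (D : BlowUpData) (θ : UnitAddCircle) : Measure ℝ :=
  if θ = D.θs then Measure.dirac (D.γ D.θs)
  else (ENNReal.ofReal (D.φ θ - D.ψ θ))⁻¹ • (volume : Measure ℝ).restrict (Icc (D.ψ θ) (D.φ θ))

theorem fibre₀_eq (θ : UnitAddCircle) :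
    D.fibre₀ θ = Measure.map (fun t : ℝ => (t : UnitAddCircle)) (D.realFibre θ) := by
  unfold fibre₀ realFibre
  split_ifs
  · rw [Measure.map_dirac' measurable_coe_circle]
  · rfl

theorem realFibre_compl (θ : UnitAddCircle) : D.realFibre θ (Ioo 0 1)ᶜ = 0 := by
  unfold realFibre
  split_ifs with h
  · rw [Measure.dirac_apply' _ measurableSet_Ioo.compl]
    simpa using D.γ_mem D.θs
  · rw [Measure.smul_apply, Measure.restrict_apply measurableSet_Ioo.compl]
    have : volume ((Ioo 0 1)ᶜ ∩ Icc (D.ψ θ) (D.φ θ)) = 0 := by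
      refine measure_mono_null (t := {0, 1}) ?_ ((Set.toFinite _).measure_zero _)
      rintro x ⟨hx, hx'⟩
      have h0 := (D.ψ_mem θ).1.trans hx'.1
      have h1 := hx'.2.trans (D.φ_mem θ).2
      rw [mem_compl_iff, mem_Ioo, not_and_or, not_lt, not_lt] at hx
      rcases hx with hx | hx
      · exact Or.inl (le_antisymm hx h0)
      · exact Or.inr (le_antisymm h1 hx)
    rw [this, smul_zero]

theorem realFibre_Iic (θ : UnitAddCircle) (s : ℝ) :
    D.realFibre θ (Iic s) = ENNReal.ofReal (D.cdf θ s) := by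
  unfold realFibre cdf
  split_ifs with h h'
  · rw [Measure.dirac_apply' _ measurableSet_Iic]
    simp [h ▸ h']
  · rw [Measure.dirac_apply' _ measurableSet_Iic]
    simp [h ▸ not_le.1 h']
  · have hpos : 0 < D.φ θ - D.ψ θ := sub_pos.2 (D.ψ_lt_φ θ h)
    have : Iic s ∩ Icc (D.ψ θ) (D.φ θ) = Icc (D.ψ θ) (min (D.φ θ) s) := by
      ext x
      simp only [mem_inter_iff, mem_Iic, mem_Icc, le_min_iff]
      tauto
    rw [Measure.smul_apply, Measure.restrict_apply measurableSet_Iic, this, Real.volume_Icc,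
      smul_eq_mul, mul_comm, ← div_eq_mul_inv, ← ENNReal.ofReal_div_of_pos hpos]
    simp [ENNReal.ofReal, Real.toNNReal, max_comm]

theorem realFibre_singleton {θ : UnitAddCircle} {s : ℝ} (hs : θ = D.θs → s ≠ D.γ D.θs) :
    D.realFibre θ {s} = 0 := by
  unfold realFibre
  split_ifs with h
  · rw [Measure.dirac_apply' _ (measurableSet_singleton s)]
    exact indicator_of_notMem (fun e => hs h e.symm) _
  · simp

theorem cdf_mono (θ : UnitAddCircle) : Monotone (D.cdf θ) := fun s t h => by
  rcases h.lt_or_eq with h | rfl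
  · exact (isLevel_cdf θ s).mono (isLevel_cdf θ t) h
  · rfl

theorem realFibre_Icc {θ : UnitAddCircle} {r s : ℝ} (hrs : r ≤ s)
    (hr : θ = D.θs → r ≠ D.γ D.θs) :
    D.realFibre θ (Icc r s) = ENNReal.ofReal (D.cdf θ s - D.cdf θ r) := by
  rw [← measure_congr (Ioc_ae_eq_Icc' (realFibre_singleton hr)), ← Iic_sdiff_Iic,
    measure_sdiff (Iic_subset_Iic.2 hrs) measurableSet_Iic.nullMeasurableSet
    (by rw [realFibre_Iic]; exact ENNReal.ofReal_ne_top), realFibre_Iic, realFibre_Iic,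
    ENNReal.ofReal_sub _ (isLevel_cdf θ r).1.1]

/-- There is no atom at the initial point, so the closed arc has the mass of the half-open one. An
atom at the final point counts, which is why the maximal selection `top` appears. -/
theorem fibre₀_arc {θ : UnitAddCircle} {r y : ℝ} (hr : r ∈ Ico (0 : ℝ) 1)
    (hy : y ∈ Ico (0 : ℝ) 1) (hne : (θ, (r : UnitAddCircle)) ≠ D.point) :
    D.fibre₀ θ ((fun t : ℝ => (t : UnitAddCircle)) '' Icc r (r + y)) =
      ENNReal.ofReal (D.top (θ, ((r + y : ℝ) : UnitAddCircle)) -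
        D.top (θ, (r : UnitAddCircle)) + y) := by
  have hr' : θ = D.θs → r ≠ D.γ D.θs := by
    rintro rfl rfl
    exact hne rfl
  have hr'' : θ = D.θs → r - 1 ≠ D.γ D.θs := fun _ h => by
    linarith [(D.γ_mem D.θs).1, hr.2]
  have hm : D.cdf θ r ≤ D.cdf θ (r + y) := cdf_mono θ (by linarith [hy.1])
  rw [fibre₀_eq, map_coe_arc (realFibre_compl θ) hr hy, realFibre_Icc (by linarith [hy.1]) hr',
    realFibre_Icc (by linarith [hy.1]) hr'', cdf_eq_zero (s := r - 1) (by linarith [hr.2]), sub_zero,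
    ← ENNReal.ofReal_add (sub_nonneg.2 hm) (isLevel_cdf _ _).1.1, top_coe hr]
  congr 1
  rcases lt_or_ge (r + y) 1 with h | h
  · rw [top_coe ⟨by linarith [hr.1, hy.1], h⟩, cdf_eq_zero (s := r - 1 + y) (by linarith)]
    ring
  · have e : ((r + y : ℝ) : UnitAddCircle) = ((r - 1 + y : ℝ) : UnitAddCircle) := by
      rw [← AddCircle.coe_add_period (1 : ℝ) (r - 1 + y)]
      congr 1; ring
    rw [e, top_coe ⟨by linarith, by linarith [hr.2, hy.2]⟩, cdf_eq_one h]
    ring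

theorem fibreIter_arc (θ : UnitAddCircle) (n : ℤ) {y : ℝ} (hy : y ∈ Ico (0 : ℝ) 1) :
    D.fibreIter n θ ((fun t : ℝ => (t : UnitAddCircle)) '' Icc 0 y) =
      ENNReal.ofReal (D.top ((θ, (y : UnitAddCircle)) - n • D.vec) -
        D.top ((θ, 0) - n • D.vec) + y) := by
  obtain ⟨r, hr, hr'⟩ := AddCircle.eq_coe_Ico (0 - n • D.ρ)
  have h0 : ((θ, 0) : Torus) - n • D.vec = (θ - n • D.ω, (r : UnitAddCircle)) := by
    rw [hr']; rfl
  have hy' : ((θ, (y : UnitAddCircle)) : Torus) - n • D.vec =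
      (θ - n • D.ω, ((r + y : ℝ) : UnitAddCircle)) := by
    refine Prod.ext rfl ?_
    rw [AddCircle.coe_add, hr', zero_sub, neg_add_eq_sub]
    rfl
  have hpre : (fun x => x + n • D.ρ) ⁻¹' ((fun t : ℝ => (t : UnitAddCircle)) '' Icc 0 y) =
      (fun t : ℝ => (t : UnitAddCircle)) '' Icc r (r + y) := by
    ext x
    constructor
    · rintro ⟨t, ht, he⟩
      refine ⟨r + t, ⟨by linarith [ht.1], by linarith [ht.2]⟩, ?_⟩
      simp only at he ⊢
      rw [AddCircle.coe_add, hr', he]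
      abel
    · rintro ⟨t, ht, rfl⟩
      refine ⟨t - r, ⟨by linarith [ht.1], by linarith [ht.2]⟩, ?_⟩
      simp only
      rw [AddCircle.coe_sub, hr']
      abel
  rw [fibreIter, Measure.map_apply (measurable_add_const _) (measurableSet_arc _ _), hpre,
    fibre₀_arc hr hy (by rw [← h0]; exact sub_zsmul_ne_point θ n), h0, hy']

/-- The terms `a n * y` and the Lebesgue part add up to `y`, since the weights have total mass one.
-/
theorem fibre_arc (θ : UnitAddCircle) {y : ℝ} (hy : y ∈ Ico (0 : ℝ) 1) :
    D.fibre θ ((fun t : ℝ => (t : UnitAddCircle)) '' Icc 0 y) =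
      ENNReal.ofReal (y + D.height (D.lift (θ, (y : UnitAddCircle))) - D.base θ) := by
  have hnn : ∀ n : ℤ, 0 ≤ D.top ((θ, (y : UnitAddCircle)) - n • D.vec) -
      D.top ((θ, 0) - n • D.vec) + y := fun n => by
    rcases hy.1.lt_or_eq with h | rfl
    · have := (level_mono (p := D.lift (θ, 0)) (p' := D.lift (θ, (y : UnitAddCircle)))
        (s := 0) rfl rfl h (by linarith [hy.2]) n).1
      rwa [sub_zero] at this
    · simp
  have hs1 := (summable_height (D.lift (θ, (y : UnitAddCircle)))).sub
    (summable_height (D.lift (θ, 0)))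
  have hs2 := D.a_summable.mul_right y
  have hs : Summable fun n : ℤ => D.a n * (D.top ((θ, (y : UnitAddCircle)) - n • D.vec) -
      D.top ((θ, 0) - n • D.vec) + y) := by
    refine (hs1.add hs2).congr fun n => ?_
    simp only [lift]
    ring
  have hsum : ∑' n : ℤ, D.a n * (D.top ((θ, (y : UnitAddCircle)) - n • D.vec) -
      D.top ((θ, 0) - n • D.vec) + y) = D.height (D.lift (θ, (y : UnitAddCircle))) - D.base θ +
        (∑' n, D.a n) * y := by
    rw [height, base, height, ← (summable_height (D.lift (θ, (y : UnitAddCircle)))).tsum_sub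
      (summable_height (D.lift (θ, 0))), ← tsum_mul_right, ← hs1.tsum_add hs2]
    exact tsum_congr fun n => by simp only [lift]; ring
  rw [fibre, Measure.add_apply, Measure.sum_apply _ (measurableSet_arc _ _)]
  simp only [Measure.smul_apply, fibreIter_arc θ _ hy, volume_arc hy, smul_eq_mul]
  simp only [← ENNReal.ofReal_mul (D.a_pos _).le]
  rw [← ENNReal.ofReal_tsum_of_nonneg (fun n => mul_nonneg (D.a_pos n).le (hnn n)) hs,
    ← ENNReal.ofReal_mul (sub_pos.2 D.a_sum_lt_one).le, ← ENNReal.ofReal_add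
      (tsum_nonneg fun n => mul_nonneg (D.a_pos n).le (hnn n))
      (mul_nonneg (sub_pos.2 D.a_sum_lt_one).le hy.1), hsum]
  congr 1
  ring

/-! ### The factor map, its fibres and the blown-up homeomorphism -/

/-- The factor map onto the rotation. -/
noncomputable def factor (D : BlowUpData) (p : Torus) : Torus := (D.chartHomeo.symm p).1.1

theorem factor_chart (p : D.space) : D.factor (D.chartHomeo p) = p.1.1 := by
  rw [factor, Homeomorph.symm_apply_apply]

theorem factor_fst (p : Torus) : (D.factor p).1 = p.1 := by
  obtain ⟨q, rfl⟩ := D.chartHomeo.surjective p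
  rw [factor_chart]
  rfl

theorem height_le_lift (p : D.space) : D.height p ≤ D.height (D.lift p.1.1) :=
  (summable_height p).tsum_le_tsum (fun n =>
    mul_le_mul_of_nonneg_left (le_top (p.2 n)) (D.a_pos n).le) (summable_height (D.lift p.1.1))

/-- If `x` is the chart coordinate of a point over `s`, then `x` is at most the maximal value
`μ_θ[0, s]`, while `height_lt` gives `μ_θ[0, y] < x` for `y < s`. -/
theorem isQuantile_factor (θ : UnitAddCircle) :
    IsQuantile (D.fibre θ) (fun x => (D.factor (θ, x)).2) := by
  intro x hx
  obtain ⟨p, hp⟩ := D.chartHomeo.surjective (θ, (x : UnitAddCircle))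
  obtain ⟨s, hs, hs'⟩ := AddCircle.eq_coe_Ico p.1.1.2
  have hpz : p.1.1 = (θ, (s : UnitAddCircle)) := Prod.ext (congrArg Prod.fst hp :) hs'.symm
  -- Membership in `[0, 1)` identifies this real number with `x`; positivity for `0 < s` is needed
  -- for a strict comparison under `ENNReal.ofReal`.
  have hmem : s + D.height p - D.base θ ∈ Ico (0 : ℝ) 1 ∧
      (0 < s → 0 < s + D.height p - D.base θ) := by
    rcases hs.1.lt_or_eq with h | rfl
    · have := height_lt (p := D.lift (θ, 0)) (p' := p) (s := 0) rfl hpz h (by linarith [hs.2])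
      rw [height_eq_base (p := D.lift (θ, 0)) rfl] at this
      have h0 : 0 < s + D.height p - D.base θ := by linarith [this.1]
      exact ⟨⟨h0.le, by linarith [this.2]⟩, fun _ => h0⟩
    · rw [height_eq_base hpz]
      norm_num
  have hx' : s + D.height p - D.base θ = x := by
    rw [chartHomeo_apply, chart_coe hpz] at hp
    exact (AddCircle.coe_eq_coe_iff_of_mem_Ico (p := (1 : ℝ)) (a := 0) (by simpa using hmem.1)
      (by simpa using hx)).1 (congrArg Prod.snd hp)
  refine ⟨s, ⟨⟨hs, ?_⟩, ?_⟩, ?_⟩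
  · rw [fibre_arc θ hs]
    refine ENNReal.ofReal_le_ofReal ?_
    have := height_le_lift p
    rw [hpz] at this
    linarith
  · rintro y ⟨hy, hle⟩
    by_contra! hlt
    have h1 := (height_lt (p := D.lift (θ, (y : UnitAddCircle))) (p' := p) rfl hpz hlt
      (by linarith [hy.1, hs.2])).1
    have h2 := hmem.2 (hy.1.trans_lt hlt)
    rw [fibre_arc θ hy] at hle
    exact hle.not_gt ((ENNReal.ofReal_lt_ofReal_iff (by linarith)).2 (by linarith))
  · simp only
    rw [← hp, factor_chart, hpz]

/-- The blown up homeomorphism. -/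
noncomputable def map (D : BlowUpData) : Torus ≃ₜ Torus :=
  D.chartHomeo.symm.trans (D.shift.trans D.chartHomeo)

theorem map_chart (p : D.space) : D.map (D.chartHomeo p) = D.chartHomeo (D.shift p) := by
  simp [map]

theorem map_fst (p : Torus) : (D.map p).1 = p.1 + D.ω := by
  obtain ⟨q, rfl⟩ := D.chartHomeo.surjective p
  rw [map_chart]
  rfl

theorem isFactorMap_factor : IsFactorMap D.map D.rot D.factor := by
  refine ⟨?_, fun z => ⟨D.chartHomeo (D.lift z), by rw [factor_chart]; rfl⟩, fun p => ?_⟩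
  · have := D.chartHomeo.symm.continuous
    unfold factor
    fun_prop
  · obtain ⟨q, rfl⟩ := D.chartHomeo.surjective p
    rw [map_chart, factor_chart, factor_chart]
    rfl

theorem mem_orbit_point {z : Torus} :
    z ∈ orbit D.rot D.point ↔ ∃ n : ℤ, z - n • D.vec = D.point := by
  refine exists_congr fun n => ?_
  dsimp only
  rw [rot, rotation_zpow_apply, sub_eq_iff_eq_add, eq_comm]
  rfl

theorem factor_injOn {z : Torus} (hz : z ∉ orbit D.rot D.point) {p p' : Torus}
    (hp : D.factor p = z) (hp' : D.factor p' = z) : p = p' := by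
  obtain ⟨q, rfl⟩ := D.chartHomeo.surjective p
  obtain ⟨q', rfl⟩ := D.chartHomeo.surjective p'
  rw [factor_chart] at hp hp'
  rw [mem_orbit_point, not_exists] at hz
  rw [eq_of_fst_eq (hp.trans hp'.symm) fun n => hp ▸ hz n]

theorem existsUnique_factor {z : Torus} (hz : z ∉ orbit D.rot D.point) :
    ∃! p : Torus, D.factor p = z := by
  obtain ⟨p, hp⟩ := (isFactorMap_factor (D := D)).2.1 z
  exact ⟨p, hp, fun p' hp' => factor_injOn hz hp' hp⟩

theorem exists_level_eq {q : D.space} {n : ℤ} (hn : q.1.1 - n • D.vec = D.point) {u : ℝ}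
    (hu : u ∈ Icc (D.top D.point - 1) (D.top D.point)) :
    ∃ q' : D.space, q'.1.1 = q.1.1 ∧ q'.1.2 n = u := by
  refine ⟨⟨(q.1.1, Function.update q.1.2 n u), fun m => ?_⟩, rfl, by simp⟩
  by_cases hm : m = n
  · subst hm
    simp only [Function.update_self, hn]
    exact mem_graph_point.2 hu
  · simp only [Function.update_of_ne hm]
    exact q.2 m

/-- The one free level fills an interval of length one and enters the height with weight `a n`, so
the fibre is an arc of length `a n < 1`. -/
theorem isVerticalSegment_factor {z : Torus} (hz : z ∈ orbit D.rot D.point) :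
    IsVerticalSegment (D.factor ⁻¹' {z}) := by
  obtain ⟨n, hn⟩ := mem_orbit_point.1 hz
  obtain ⟨θ, y⟩ := z
  obtain ⟨s, hs, rfl⟩ := AddCircle.eq_coe_Ico y
  set q₀ : D.space := D.lift (θ, (s : UnitAddCircle)) with hq₀
  have hlev : q₀.1.2 n = D.top D.point := congrArg D.top hn
  set d : ℝ := s + D.height q₀ - D.base θ with hd
  have hpos := D.a_pos n
  have hval : ∀ q : D.space, q.1.1 = (θ, (s : UnitAddCircle)) → D.chartHomeo q =
      (θ, ((d - D.a n * (D.top D.point - q.1.2 n) : ℝ) : UnitAddCircle)) := fun q hq => by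
    have h := height_sub (p := q₀) (p' := q) hq.symm hn
    rw [hlev] at h
    rw [chartHomeo_apply, chart_coe hq, ← h]
    exact congrArg (fun t : ℝ => (θ, (t : UnitAddCircle))) (by rw [hd]; ring)
  refine ⟨θ, d - D.a n, d, by linarith, by linarith [a_lt_one (D := D) n], ?_⟩
  ext p
  obtain ⟨q, rfl⟩ := D.chartHomeo.surjective p
  rw [mem_preimage, mem_singleton_iff, factor_chart]
  constructor
  · intro hq
    have hu := q.2 n
    rw [hq, hn, mem_graph_point] at hu
    rw [hval q hq]
    refine ⟨rfl, _, ⟨?_, ?_⟩, rfl⟩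
    · nlinarith [hu.1]
    · nlinarith [hu.2]
  · rintro ⟨h1, x, hx, h2⟩
    obtain ⟨q', hq', hu⟩ := exists_level_eq (q := q₀) hn
      (u := D.top D.point - (d - x) / D.a n)
      ⟨by linarith [(div_le_one hpos).2 (by linarith [hx.1] : d - x ≤ D.a n)],
        by linarith [div_nonneg (by linarith [hx.2] : 0 ≤ d - x) hpos.le]⟩
    have h3 : D.chartHomeo q' = D.chartHomeo q := by
      rw [hval q' hq', hu, sub_sub_cancel, mul_div_cancel₀ _ hpos.ne', sub_sub_cancel]
      exact Prod.ext h1.symm h2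
    rw [← D.chartHomeo.injective h3]
    exact hq'

theorem dist_le_of_factor_eq {p p' : Torus} (h : D.factor p = D.factor p') {n : ℤ}
    (hn : D.factor p - n • D.vec = D.point) : dist p p' ≤ D.a n := by
  obtain ⟨q, rfl⟩ := D.chartHomeo.surjective p
  obtain ⟨q', rfl⟩ := D.chartHomeo.surjective p'
  rw [factor_chart] at hn
  rw [factor_chart, factor_chart] at h
  have h1 := height_sub h hn
  have h2 := abs_sub_le_of_mem_graph (q.2 n) (h ▸ q'.2 n)
  have hpos := D.a_pos n
  rw [Prod.dist_eq, chartHomeo_apply, chartHomeo_apply, chart, chart, h]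
  simp only [dist_self, dist_add_left]
  refine max_le hpos.le ?_
  rw [dist_eq_norm, ← AddCircle.coe_sub, sub_sub_sub_cancel_right, h1]
  refine (norm_coe_le_abs _).trans ?_
  rw [abs_mul, abs_of_pos hpos]
  exact mul_le_of_le_one_right hpos.le h2

theorem not_isDistalPoint_map {p : Torus} (hp : D.factor p ∈ orbit D.rot D.point) :
    ¬ IsDistalPoint D.map p := by
  obtain ⟨n, hn⟩ := mem_orbit_point.1 hp
  obtain ⟨p', hp', hne⟩ : ∃ p', D.factor p' = D.factor p ∧ p' ≠ p := by
    obtain ⟨q, rfl⟩ := D.chartHomeo.surjective p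
    rw [factor_chart] at hn
    obtain ⟨u, hu, hne⟩ : ∃ u ∈ Icc (D.top D.point - 1) (D.top D.point), u ≠ q.1.2 n := by
      rcases eq_or_ne (q.1.2 n) (D.top D.point) with h | h
      · exact ⟨D.top D.point - 1, ⟨le_rfl, by linarith⟩, by rw [h]; linarith⟩
      · exact ⟨D.top D.point, ⟨by linarith, le_rfl⟩, h.symm⟩
    obtain ⟨q', hq', hu'⟩ := exists_level_eq hn hu
    refine ⟨D.chartHomeo q', by rw [factor_chart, factor_chart, hq'], fun h => hne ?_⟩
    rw [← hu', D.chartHomeo.injective h]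
  refine not_isDistalPoint hne ?_
  -- The `k`-th iterate moves the free level from index `n` to `n + k`, and summable weights tend to
  -- zero.
  have ha : Tendsto (fun k : ℕ => D.a (n + k)) atTop (𝓝 0) := by
    have hinj : Function.Injective fun k : ℕ => n + (k : ℤ) := fun i j h => by
      simpa using h
    have := D.a_summable.tendsto_cofinite_zero.comp hinj.tendsto_cofinite
    rwa [Nat.cofinite_eq_atTop] at this
  refine squeeze_zero (fun _ => dist_nonneg) (fun k => ?_) ha
  have hfac : ∀ x, D.factor ((D.map ^ (k : ℤ)) x) = D.factor x + (k : ℤ) • D.vec := fun x => by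
    rw [zpow_semiconj isFactorMap_factor.2.2, rot, rotation_zpow_apply]
    rfl
  refine dist_le_of_factor_eq (by rw [hfac, hfac, hp']) ?_
  rw [hfac, add_zsmul, add_sub_add_right_eq_sub, hn]

theorem notMem_orbit_of_regular {z : Torus} (hz : ∀ n : ℤ, z.1 - n • D.ω ≠ D.θs) :
    z ∉ orbit D.rot D.point := by
  rw [mem_orbit_point, not_exists]
  exact fun n h => hz n (congrArg (fun w : Torus => w.1) h)

theorem isMinimal_map (hD : IsMinimal D.rot) : IsMinimal D.map := by
  refine isFactorMap_factor.isMinimal hD (dense_regular (D := D)) fun p hp p' h => ?_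
  refine factor_injOn (notMem_orbit_of_regular fun n => ?_) h rfl
  rw [factor_fst]
  exact hp n

end BlowUpData

end ReesTorus

theorem mainTheorem6 :
    ∃ (D : ReesTorus.BlowUpData) (f : ReesTorus.Torus ≃ₜ ReesTorus.Torus)
      (h : ReesTorus.Torus → ReesTorus.Torus),
      -- dynamical properties of `f`
      ReesTorus.IsMinimal f ∧
      ReesTorus.IsAlmostAutomorphic f ∧
      ReesTorus.IsPointDistal f ∧
      ¬ ReesTorus.IsDistal f ∧
      -- `f` is a skew product over the circle rotation by `ω`
      (∀ p : ReesTorus.Torus, (f p).1 = p.1 + D.ω) ∧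
      -- `h` is given on fibres by the quantile functions of the measures `μ_θ`
      (∀ p : ReesTorus.Torus, (h p).1 = p.1) ∧
      (∀ θ : UnitAddCircle, ReesTorus.IsQuantile (D.fibre θ) (fun x => (h (θ, x)).2)) ∧
      -- `h` is a factor map from `f` to the irrational rotation
      ReesTorus.IsFactorMap f D.rot h ∧
      -- exactly the points of one orbit of the rotation are blown up, to vertical segments
      (∀ z ∈ ReesTorus.orbit D.rot D.point, ReesTorus.IsVerticalSegment (h ⁻¹' {z})) ∧
      (∀ z ∉ ReesTorus.orbit D.rot D.point, ∃! p : ReesTorus.Torus, h p = z) ∧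
      -- the non-distal points are exactly the points of these segments
      {p : ReesTorus.Torus | ¬ ReesTorus.IsDistalPoint f p} =
        h ⁻¹' (ReesTorus.orbit D.rot D.point) := by
  obtain ⟨D, hD⟩ := ReesTorus.exists_blowUpData
  have hfac := ReesTorus.BlowUpData.isFactorMap_factor (D := D)
  have hinj : ∀ p, D.factor p ∉ ReesTorus.orbit D.rot D.point →
      ∀ y, D.factor y = D.factor p → y = p :=
    fun p hp y hy => ReesTorus.BlowUpData.factor_injOn hp hy rfl
  obtain ⟨z, hz⟩ := (ReesTorus.BlowUpData.dense_regular (D := D)).nonempty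
  obtain ⟨p, rfl⟩ := hfac.2.1 z
  have hp := ReesTorus.BlowUpData.notMem_orbit_of_regular hz
  obtain ⟨q, hq⟩ := hfac.2.1 D.point
  have hq' : D.factor q ∈ ReesTorus.orbit D.rot D.point := hq ▸ ⟨0, rfl⟩
  refine ⟨D, D.map, D.factor, ReesTorus.BlowUpData.isMinimal_map hD,
    hfac.isAlmostAutomorphic (hinj p hp), ⟨p, hfac.isDistalPoint (hinj p hp)⟩,
    fun h => ReesTorus.BlowUpData.not_isDistalPoint_map hq' (h q),
    ReesTorus.BlowUpData.map_fst, ReesTorus.BlowUpData.factor_fst,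
    ReesTorus.BlowUpData.isQuantile_factor, hfac,
    fun _ => ReesTorus.BlowUpData.isVerticalSegment_factor,
    fun _ => ReesTorus.BlowUpData.existsUnique_factor, Set.ext fun x => ⟨fun hx => ?_,
      ReesTorus.BlowUpData.not_isDistalPoint_map⟩⟩
  by_contra hmem
  exact hx (hfac.isDistalPoint (hinj x hmem))
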